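/- Let $\mathbb K\in\{\mathbb R,\mathbb C\}$; all Banach spaces are over $\mathbb K$ and operators are bounded and linear. Let $\mathcal D=\bigcup_{n<\omega}\{0,1\}^n$ be the set of finite sequences in $\{0,1\}$. For $s\in\{0,1\}^\omega$ let $s|_n\in\{0,1\}^n$ be the initial segment of $s$ of length $n$, and for $t\in\mathcal D$ let $\Delta_t\subseteq\{0,1\}^\omega$ be the set of sequences that have $t$ as an initial segment. Let $\{0,1\}^\omega$ carry the product topology, let $(e_t)_{t\in\mathcal D}$ be the unit vector basis of $\ell_1(\mathcal D)$, and let $S:\ell_1(\mathcal D)\to C(\{0,1\}^\omega)$ be the operator $$(Sx)(s)=\sum_{n<\omega}x(s|_n),\qquad x\in\ell_1(\mathcal D),\ s\in\{0,1\}^\omega,$$ that is, $Se_t=\chi_{\Delta_t}$ for every $t\in\mathcal D$. Let $X$ and $Y$ be Banach spaces with $Y$ separable, and let $T:X\to Y$ be an operator whose adjoint $T^*:Y^*\to X^*$ has norm non-separable range. Then $S$ factors through $T$: there are operators $U:\ell_1(\mathcal D)\to X$ and $V:Y\to C(\{0,1\}^\omega)$ with $VTU=S$. It follows that $S$ is universal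 for the class of operators between Banach spaces that have separable codomain and adjoint with non-separable range; that is, $S$ itself belongs to this class ($C(\{0,1\}^\omega)$ is separable and $S^*$ has non-separable range), and $S$ factors through every member of the class. -/

import Mathlib

universe u v w

noncomputable section

namespace UnivOp

/-- The set `𝒟 = ⋃ₙ {0,1}ⁿ` of finite sequences in `{0,1}`. -/
abbrev DyadicTree : Type := Σ n : ℕ, (Fin n → Bool)

/-- The space `{0,1}^ω`, with the product topology. -/
abbrev CantorSpace : Type := ℕ → Bool

/-- The initial segment `s|ₙ` of `s`, of length `n`. -/
def initSeg (s : CantorSpace) (n : ℕ) : DyadicTree := ⟨n, fun k => s k⟩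

/-- `Δ_t`: all elements of `{0,1}^ω` that have `t` as an initial segment. -/
def cylinder (t : DyadicTree) : Set CantorSpace := {s | ∀ k : Fin t.1, s k = t.2 k}

/-- The Banach space `ℓ₁(𝒟)`. -/
abbrev ell1Dyadic (𝕜 : Type*) [RCLike 𝕜] : Type _ := lp (fun _ : DyadicTree => 𝕜) 1

section operator

variable {𝕜 : Type*} [RCLike 𝕜]

/-- The unit vector `e_t` of `ℓ₁(𝒟)`. -/
def unitVec (𝕜 : Type*) [RCLike 𝕜] (t : DyadicTree) : ell1Dyadic 𝕜 := lp.single 1 t (1 : 𝕜)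

theorem summable_norm (x : ell1Dyadic 𝕜) : Summable fun t => ‖x t‖ := by
  have h := (lp.memℓp x).summable (by simp)
  simpa using h

theorem norm_eq (x : ell1Dyadic 𝕜) : ‖x‖ = ∑' t, ‖x t‖ := by
  have h := lp.norm_eq_tsum_rpow (p := 1) (by simp) x
  simpa using h

theorem initSeg_injective (s : CantorSpace) : Function.Injective (initSeg s) := by
  intro m n h
  exact congrArg Sigma.fst h

theorem summable_branch_norm (x : ell1Dyadic 𝕜) (s : CantorSpace) :
    Summable fun n => ‖x (initSeg s n)‖ :=
  (summable_norm x).comp_injective (initSeg_injective s)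

theorem summable_branch (x : ell1Dyadic 𝕜) (s : CantorSpace) :
    Summable fun n => x (initSeg s n) :=
  (summable_branch_norm x s).of_norm

theorem continuous_branchSum (x : ell1Dyadic 𝕜) :
    Continuous fun s : CantorSpace => ∑' n, x (initSeg s n) := by
  refine continuous_tsum (u := fun n => ∑' v : Fin n → Bool, ‖x ⟨n, v⟩‖) ?_ ?_ ?_
  · intro n
    have h : Continuous fun s : CantorSpace => fun k : Fin n => s k := by fun_prop
    exact (continuous_of_discreteTopology (f := fun v : Fin n → Bool => x ⟨n, v⟩)).comp h
  · exact (summable_norm x).sigma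
  · intro n s
    exact ((summable_norm x).sigma_factor n).le_tsum (fun k : Fin n => s k)
      (fun _ _ => norm_nonneg _)

/-- The operator `S : ℓ₁(𝒟) → C({0,1}^ω)`, `(S x)(s) = ∑_{n < ω} x(s|ₙ)`. -/
def branchSumOp (𝕜 : Type*) [RCLike 𝕜] : ell1Dyadic 𝕜 →L[𝕜] C(CantorSpace, 𝕜) :=
  LinearMap.mkContinuous
    { toFun := fun x => ⟨fun s => ∑' n, x (initSeg s n), continuous_branchSum x⟩
      map_add' := fun x y => by
        ext s
        exact (summable_branch x s).tsum_add (summable_branch y s)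
      map_smul' := fun c x => by
        ext s
        exact (summable_branch x s).tsum_mul_left c }
    1
    (fun x => by
      rw [one_mul, ContinuousMap.norm_le _ (norm_nonneg x)]
      intro s
      refine (norm_tsum_le_tsum_norm (summable_branch_norm x s)).trans ?_
      rw [norm_eq]
      exact tsum_comp_le_tsum_of_inj (summable_norm x) (fun _ => norm_nonneg _)
        (initSeg_injective s))

end operator

section classes

variable {𝕜 : Type*} [RCLike 𝕜]

/-- The adjoint `T* : Y* → X*`, `T* g = g ∘ T`, between the duals with their norm topologies. -/
def adjointOp {X Y : Type*} [NormedAddCommGroup X] [NormedSpace 𝕜 X]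
    [NormedAddCommGroup Y] [NormedSpace 𝕜 Y] (T : X →L[𝕜] Y) :
    StrongDual 𝕜 Y →L[𝕜] StrongDual 𝕜 X :=
  ContinuousLinearMap.precomp 𝕜 T

/-- `S : W → Z` factors through `T : X → Y`: there are operators `U : W → X` and `V : Y → Z`
with `V T U = S`. -/
def FactorsThrough {W X Y Z : Type*}
    [NormedAddCommGroup W] [NormedSpace 𝕜 W] [NormedAddCommGroup X] [NormedSpace 𝕜 X]
    [NormedAddCommGroup Y] [NormedSpace 𝕜 Y] [NormedAddCommGroup Z] [NormedSpace 𝕜 Z]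
    (S : W →L[𝕜] Z) (T : X →L[𝕜] Y) : Prop :=
  ∃ (U : W →L[𝕜] X) (V : Y →L[𝕜] Z), (V.comp T).comp U = S

/-- Membership in the class of operators that have separable codomain and whose adjoint has
(norm) non-separable range. -/
def SepCodNonsepAdj {X Y : Type*} [NormedAddCommGroup X] [NormedSpace 𝕜 X]
    [NormedAddCommGroup Y] [NormedSpace 𝕜 Y] (T : X →L[𝕜] Y) : Prop :=
  TopologicalSpace.SeparableSpace Y ∧
    ¬ TopologicalSpace.IsSeparable (Set.range (adjointOp T))

/-- `S` is universal for the class of operators between Banach spaces that have separable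
codomain and adjoint with non-separable range: it belongs to the class and factors through every
member of the class. (Domains and codomains range over arbitrary universes `u₁` and `v₁`.) -/
def IsUniversalSepCodNonsepAdj.{u₁, v₁, w₁, a₁, b₁} {𝕜 : Type w₁} [RCLike 𝕜] {W : Type a₁} {Z : Type b₁}
    [NormedAddCommGroup W] [NormedSpace 𝕜 W] [NormedAddCommGroup Z] [NormedSpace 𝕜 Z]
    (S : W →L[𝕜] Z) : Prop :=
  SepCodNonsepAdj S ∧
    ∀ (X : Type u₁) (Y : Type v₁) [NormedAddCommGroup X] [NormedSpace 𝕜 X] [CompleteSpace X]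
      [NormedAddCommGroup Y] [NormedSpace 𝕜 Y] [CompleteSpace Y] (T : X →L[𝕜] Y),
      SepCodNonsepAdj T → FactorsThrough S T

end classes

end UnivOp

end

/-!
A norm non-separable range of `T*` makes the image under `T*` of the unit ball of `Y*`
non-separable, so for some `δ > 0` that image is not within `δ` of any countably spanned subspace.
Hence the functionals `y` in the ball with `T* y` far from a countably spanned subspace generate a
proper countably complete filter. As the ball is weak* compact and metrizable, hence hereditarily
Lindelöf, the set `S` of cluster points of this filter belongs to it. Therefore each weak*
neighbourhood of a point of `S` contains `a ∈ S` for which `T* a` is `δ`-far from any prescribed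
finite-dimensional subspace of `X*`; by Hahn–Banach some `v ∈ X` with `‖v‖ ≤ 1/δ` satisfies
`a (T v) = 1` and is annihilated by that subspace.

Choose such functionals `y_t` and vectors `u_t` along the dyadic tree, each `y_t` weak* close to
the functional at the predecessor of `t`. The increments of `y` along the edges are almost
biorthogonal to `T u_t`, and Gaussian elimination turns them into exactly biorthogonal `φ_t` at the
cost of a summable perturbation. Sums of increments along a branch telescope, so the branch sums of
`φ` are bounded, while `(φ_t z)_t` is in `ℓ₁` for all `z` in a dense subspace. Hence
`V z = S ((φ_t z)_t)` extends to a bounded operator although `z ↦ (φ_t z)_t` itself need not be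
bounded, and `V T U = S` for `U e_t = u_t`.

That `S*` has non-separable range is seen from the point evaluations, whose images under `S*` are
at mutual distance at least `1`.
-/

namespace UnivOp

open Filter Topology TopologicalSpace

section Kernels

variable {𝕜 X : Type*} [NormedField 𝕜] [AddCommGroup X] [Module 𝕜 X]
  [TopologicalSpace X]

theorem mem_span_of_forall_apply_eq_zero {G : Set (StrongDual 𝕜 X)} (hG : G.Finite)
    {f : StrongDual 𝕜 X} (h : ∀ x, (∀ g ∈ G, g x = 0) → f x = 0) :
    f ∈ Submodule.span 𝕜 G := by
  have := hG.to_subtype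
  have hker : ⨅ g : G, LinearMap.ker (g : StrongDual 𝕜 X).toLinearMap ≤
      LinearMap.ker f.toLinearMap := fun x hx =>
    h x fun g hg => (Submodule.mem_iInf _).1 hx ⟨g, hg⟩
  have hmem := mem_span_of_iInf_ker_le_ker hker
  have hrange : Set.range (fun g : G => (g : StrongDual 𝕜 X).toLinearMap) =
      (ContinuousLinearMap.coeLM 𝕜 : StrongDual 𝕜 X →ₗ[𝕜] X →ₗ[𝕜] 𝕜) '' G :=
    Set.range_comp (ContinuousLinearMap.coeLM 𝕜 : StrongDual 𝕜 X →ₗ[𝕜] X →ₗ[𝕜] 𝕜)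
      (Subtype.val : G → _) |>.trans (by rw [Subtype.range_coe])
  rw [hrange, ← Submodule.map_span] at hmem
  obtain ⟨g, hg, hgf⟩ := hmem
  exact ContinuousLinearMap.coe_injective hgf ▸ hg

end Kernels

section Duality

variable {𝕜 X : Type*} [RCLike 𝕜] [SeminormedAddCommGroup X] [NormedSpace 𝕜 X]

theorem exists_mem_span_norm_sub_le {G : Set (StrongDual 𝕜 X)} (hG : G.Finite)
    {f : StrongDual 𝕜 X} {δ : ℝ} (hδ : 0 ≤ δ)
    (h : ∀ x, (∀ g ∈ G, g x = 0) → ‖f x‖ ≤ δ * ‖x‖) :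
    ∃ g ∈ Submodule.span 𝕜 G, ‖f - g‖ ≤ δ := by
  let p : Submodule 𝕜 X := ⨅ g ∈ G, LinearMap.ker g.toLinearMap
  have mem_p {x : X} : x ∈ p ↔ ∀ g ∈ G, g x = 0 := by simp [p]
  obtain ⟨g₀, hg₀, hg₀_norm⟩ := exists_extension_norm_eq p (f.comp p.subtypeL)
  refine ⟨f - g₀, mem_span_of_forall_apply_eq_zero hG fun x hx => ?_, ?_⟩
  · exact sub_eq_zero.2 (hg₀ ⟨x, mem_p.2 hx⟩).symm
  · rw [sub_sub_cancel, hg₀_norm]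
    exact (f.comp p.subtypeL).opNorm_le_bound hδ fun x => h x (mem_p.1 x.2)

theorem exists_apply_eq_one_of_forall_lt_norm_sub {G : Set (StrongDual 𝕜 X)} (hG : G.Finite)
    {f : StrongDual 𝕜 X} {δ : ℝ} (hδ : 0 < δ) (h : ∀ g ∈ Submodule.span 𝕜 G, δ < ‖f - g‖) :
    ∃ v : X, ‖v‖ ≤ δ⁻¹ ∧ f v = 1 ∧ ∀ g ∈ G, g v = 0 := by
  obtain ⟨x, hxG, hx⟩ : ∃ x, (∀ g ∈ G, g x = 0) ∧ δ * ‖x‖ < ‖f x‖ := by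
    by_contra! hle
    obtain ⟨g, hg, hfg⟩ := exists_mem_span_norm_sub_le hG hδ.le hle
    exact (h g hg).not_ge hfg
  have hfx : 0 < ‖f x‖ := (by positivity : 0 ≤ δ * ‖x‖).trans_lt hx
  refine ⟨(f x)⁻¹ • x, ?_, ?_, fun g hg => ?_⟩
  · rw [norm_smul, norm_inv, inv_mul_le_iff₀ hfx, ← div_eq_mul_inv, le_div_iff₀' hδ]
    exact hx.le
  · rw [map_smul, smul_eq_mul, inv_mul_cancel₀ (norm_pos_iff.1 hfx)]
  · rw [map_smul, hxG g hg, smul_zero]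

end Duality

section FarFilter

variable {𝕜 E : Type*} [NormedField 𝕜] [SeminormedAddCommGroup E] [NormedSpace 𝕜 E]

/-- The filter on `E` generated by the sets of vectors at distance more than `δ` from the span of
a countable set. The complement of a member is `δ`-close to a separable subspace, so this filter
plays the role of the co-countable filter when condensation points are extracted from a
non-separable set. -/
def farFilter (𝕜 : Type*) {E : Type*} [NormedField 𝕜] [SeminormedAddCommGroup E]
    [NormedSpace 𝕜 E] (δ : ℝ) : Filter E :=
  Filter.ofCountableInter
    {A | ∃ C : Set E, C.Countable ∧ {x | ∀ g ∈ Submodule.span 𝕜 C, δ < ‖x - g‖} ⊆ A}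
    (fun S hS hSA => by
      have hC : ∀ A ∈ S, ∃ C : Set E, C.Countable ∧
          {x | ∀ g ∈ Submodule.span 𝕜 C, δ < ‖x - g‖} ⊆ A := hSA
      choose! C hC hCA using hC
      refine ⟨⋃ A ∈ S, C A, hS.biUnion hC, fun x hx => Set.mem_sInter.2 fun A hA => ?_⟩
      exact hCA A hA fun g hg => hx g (Submodule.span_mono (Set.subset_biUnion_of_mem hA) hg))
    (fun _ _ ⟨C, hC, hCA⟩ hAB => ⟨C, hC, hCA.trans hAB⟩)

instance (δ : ℝ) : CountableInterFilter (farFilter 𝕜 δ : Filter E) :=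
  inferInstanceAs (CountableInterFilter (Filter.ofCountableInter _ _ _))

theorem eventually_farFilter {δ : ℝ} {C : Set E} (hC : C.Countable) :
    ∀ᶠ x in farFilter 𝕜 δ, ∀ g ∈ Submodule.span 𝕜 C, δ < ‖x - g‖ :=
  ⟨C, hC, subset_rfl⟩

theorem exists_frequently_farFilter_mem [SeparableSpace 𝕜] {A : Set E} (hA : ¬ IsSeparable A) :
    ∃ δ > 0, ∃ᶠ x in farFilter 𝕜 δ, x ∈ A := by
  by_contra! hev
  have hcover (n : ℕ) : ∃ C : Set E, C.Countable ∧
      ∀ x ∈ A, ∃ g ∈ Submodule.span 𝕜 C, ‖x - g‖ ≤ 1 / (n + 1) := by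
    obtain ⟨C, hC, hCA⟩ := hev (1 / ((n : ℝ) + 1)) Nat.one_div_pos_of_nat
    refine ⟨C, hC, fun x hx => ?_⟩
    by_contra! hfar
    exact hCA hfar hx
  choose C hC hCA using hcover
  have hsep : IsSeparable (closure (Submodule.span 𝕜 (⋃ n, C n) : Set E)) :=
    (Set.countable_iUnion hC).isSeparable.span.closure
  refine hA (hsep.mono fun x hx => Metric.mem_closure_iff.2 fun ε hε => ?_)
  obtain ⟨n, hn⟩ := exists_nat_one_div_lt hε
  obtain ⟨g, hg, hxg⟩ := hCA n x hx
  exact ⟨g, Submodule.span_mono (Set.subset_iUnion C n) hg,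
    (dist_eq_norm x g).trans_le hxg |>.trans_lt hn⟩

end FarFilter

theorem eventually_clusterPt {α : Type*} [TopologicalSpace α] [HereditarilyLindelofSpace α]
    (l : Filter α) [CountableInterFilter l] : ∀ᶠ x in l, ClusterPt x l := by
  suffices h : {x | ¬ ClusterPt x l}ᶜ ∈ l by
    filter_upwards [h] with x hx using not_not.1 hx
  refine (HereditarilyLindelofSpace.isLindelof _).compl_mem_sets fun x hx => ?_
  rw [not_neBot.1 hx]
  exact mem_bot

section UnitBall

variable {𝕜 X Y : Type*} [NontriviallyNormedField 𝕜] [SeminormedAddCommGroup X] [NormedSpace 𝕜 X]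
  [SeminormedAddCommGroup Y] [NormedSpace 𝕜 Y]

theorem hereditarilyLindelofSpace_weakDual_closedBall [ProperSpace 𝕜] [SeparableSpace Y] (r : ℝ) :
    HereditarilyLindelofSpace
      (WeakDual.toStrongDual ⁻¹' Metric.closedBall (0 : StrongDual 𝕜 Y) r) := by
  have hK := WeakDual.isCompact_closedBall (𝕜 := 𝕜) (E := Y) 0 r
  have := WeakDual.metrizable_of_isCompact 𝕜 Y _ hK
  have := isCompact_iff_compactSpace.1 hK
  let := metrizableSpaceMetric
    (WeakDual.toStrongDual ⁻¹' Metric.closedBall (0 : StrongDual 𝕜 Y) r)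
  infer_instance

theorem isSeparable_range_of_isSeparable_image_closedBall [SeparableSpace 𝕜] {T : X →L[𝕜] Y}
    (h : IsSeparable (T '' Metric.closedBall 0 1)) : IsSeparable (Set.range T) := by
  have hball : Submodule.span 𝕜 (Metric.closedBall (0 : X) 1) = ⊤ :=
    Submodule.eq_top_of_nonempty_interior' _
      ⟨0, interior_mono Submodule.subset_span
        (mem_interior_iff_mem_nhds.2 (Metric.closedBall_mem_nhds 0 one_pos))⟩
  have hrange : Set.range T = Submodule.span 𝕜 (T '' Metric.closedBall 0 1) := by
    rw [← ContinuousLinearMap.coe_coe, ← Submodule.map_span, hball, Submodule.map_top,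
      LinearMap.coe_range]
  rw [hrange]
  exact h.span

end UnitBall

section PerfectSet

variable {𝕜 X Y : Type*} [RCLike 𝕜] [NormedAddCommGroup X] [NormedSpace 𝕜 X]
  [NormedAddCommGroup Y] [NormedSpace 𝕜 Y]

/-- A set `S` of functionals on `Y` such that every weak* neighbourhood in `S` of a point of `S`
contains, for every finite set `F` of functionals, some `a` that is separated from `F` by a vector
of the range of `T`: there is `v` with `‖v‖ ≤ C`, `a (T v) = 1` and `f (T v) = 0` for `f ∈ F`.
Weak* neighbourhoods are described by a finite set `Z` of vectors and a radius `ε`. -/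
def IsDualPerfect (T : X →L[𝕜] Y) (C : ℝ) (S : Set (StrongDual 𝕜 Y)) : Prop :=
  ∀ y ∈ S, ∀ Z : Set Y, Z.Finite → ∀ ε > 0, ∀ F : Set (StrongDual 𝕜 Y), F.Finite →
    ∃ a ∈ S, (∀ z ∈ Z, ‖(a - y) z‖ < ε) ∧
      ∃ v : X, ‖v‖ ≤ C ∧ a (T v) = 1 ∧ ∀ f ∈ F, f (T v) = 0

theorem exists_isDualPerfect [SeparableSpace Y] {T : X →L[𝕜] Y}
    (hT : ¬ IsSeparable (Set.range (adjointOp T))) :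
    ∃ (C : ℝ) (S : Set (StrongDual 𝕜 Y)),
      S.Nonempty ∧ (∀ y ∈ S, ‖y‖ ≤ 1) ∧ IsDualPerfect T C S := by
  let K := WeakDual.toStrongDual ⁻¹' Metric.closedBall (0 : StrongDual 𝕜 Y) 1
  have : HereditarilyLindelofSpace K := hereditarilyLindelofSpace_weakDual_closedBall 1
  obtain ⟨δ, hδ, hfar⟩ := exists_frequently_farFilter_mem (𝕜 := 𝕜)
    (mt isSeparable_range_of_isSeparable_image_closedBall hT)
  let l : Filter K := comap (fun y => adjointOp T (WeakDual.toStrongDual y.1)) (farFilter 𝕜 δ)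
  have : l.NeBot := comap_neBot_iff_frequently.2 <| hfar.mono <| by
    rintro _ ⟨y, hy, rfl⟩
    exact ⟨⟨StrongDual.toWeakDual y, hy⟩, rfl⟩
  refine ⟨δ⁻¹, {y | ∃ h : StrongDual.toWeakDual y ∈ K, ClusterPt ⟨_, h⟩ l}, ?_, ?_, ?_⟩
  · obtain ⟨y, hy⟩ := (eventually_clusterPt l).exists
    exact ⟨WeakDual.toStrongDual y.1, y.2, hy⟩
  · exact fun y hy => mem_closedBall_zero_iff.1 hy.1
  · rintro y ⟨hyK, hy⟩ Z hZ ε hε F hF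
    have hnear : ∀ᶠ a : K in 𝓝 ⟨_, hyK⟩, ∀ z ∈ Z, ‖a.1 z - y z‖ < ε := by
      refine (eventually_all_finite hZ).2 fun z _ => ?_
      have hcont : Continuous fun a : K => ‖a.1 z - y z‖ :=
        (((WeakDual.eval_continuous z).comp continuous_subtype_val).sub continuous_const).norm
      refine hcont.continuousAt.eventually_lt_const ?_
      simpa using hε
    have hfarF : ∀ᶠ a : K in l, ∀ g ∈ Submodule.span 𝕜 (adjointOp T '' F),
        δ < ‖adjointOp T (WeakDual.toStrongDual a.1) - g‖ :=
      (eventually_farFilter (hF.image _).countable).comap _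
    have : (𝓝 ⟨_, hyK⟩ ⊓ l).NeBot := hy
    obtain ⟨a, haZ, haF, ha⟩ := ((hnear.filter_mono inf_le_left).and
      ((hfarF.and (eventually_clusterPt l)).filter_mono inf_le_right)).exists
    obtain ⟨v, hv, hav, hFv⟩ :=
      exists_apply_eq_one_of_forall_lt_norm_sub (hF.image _) hδ haF
    exact ⟨WeakDual.toStrongDual a.1, ⟨a.2, ha⟩, haZ, v, hv, hav,
      fun f hf => hFv _ (Set.mem_image_of_mem _ hf)⟩

end PerfectSet

theorem exists_seq_forall_fin {α : Type*} {P : ∀ n : ℕ, (Fin n → α) → α → Prop}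
    (h : ∀ n f, ∃ a, P n f a) : ∃ f : ℕ → α, ∀ n, P n (fun i => f i) (f n) := by
  choose next hnext using h
  let f : ℕ → α := Nat.strongRec fun n prev => next n fun i => prev i i.2
  refine ⟨f, fun n => ?_⟩
  have hf : f n = next n fun i => f i := Nat.strongRec_eq _ n
  rw [hf]
  exact hnext n _

section Increment

/-- The increments of a family `y` along the edges of the tree on `ℕ` with root `0` in which
`parent k` is the predecessor of `k`; the increment at the root is `y 0`. -/
def increment {E : Type*} [AddCommGroup E] (parent : ℕ → ℕ) (y : ℕ → E) (k : ℕ) : E :=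
  if k = 0 then y 0 else y k - y (parent k)

variable {parent : ℕ → ℕ}

theorem increment_of_ne_zero {E : Type*} [AddCommGroup E] (y : ℕ → E) {k : ℕ} (hk : k ≠ 0) :
    increment parent y k = y k - y (parent k) :=
  if_neg hk

theorem sum_increment_path {E : Type*} [AddCommGroup E] (y : ℕ → E) {path : ℕ → ℕ}
    (h_zero : path 0 = 0) (h_succ : ∀ m, path (m + 1) ≠ 0 ∧ parent (path (m + 1)) = path m)
    (n : ℕ) :
    ∑ m ∈ Finset.range (n + 1), increment parent y (path m) = y (path n) := by
  induction n with
  | zero => simp [h_zero, increment]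
  | succ n ih =>
    rw [Finset.sum_range_succ, ih, increment_of_ne_zero y (h_succ n).1, (h_succ n).2,
      add_sub_cancel]

theorem norm_increment_le {E : Type*} [SeminormedAddCommGroup E] {y : ℕ → E} {M : ℝ}
    (hy : ∀ k, ‖y k‖ ≤ M) (k : ℕ) :
    ‖increment parent y k‖ ≤ 2 * M := by
  rw [increment, two_mul]
  split_ifs
  · exact (hy 0).trans (le_add_of_nonneg_left ((norm_nonneg _).trans (hy 0)))
  · exact norm_sub_le_of_le (hy k) (hy _)

section Functionals

variable {𝕜 Y : Type*} [NormedField 𝕜] [AddCommGroup Y] [Module 𝕜 Y] [TopologicalSpace Y]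
  {y : ℕ → StrongDual 𝕜 Y} {x : ℕ → Y}

theorem increment_apply_eq_zero (h_parent : ∀ k ≠ 0, parent k < k)
    (h_upper : ∀ i, ∀ k < i, y k (x i) = 0) {i k : ℕ} (hki : k < i) :
    increment parent y k (x i) = 0 := by
  by_cases hk : k = 0
  · rw [increment, if_pos hk, h_upper i 0 (hk ▸ hki)]
  · rw [increment_of_ne_zero y hk, _root_.sub_apply, h_upper i k hki,
      h_upper i _ ((h_parent k hk).trans hki), sub_zero]

theorem increment_apply_self (h_parent : ∀ k ≠ 0, parent k < k) (h_diag : ∀ k, y k (x k) = 1)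
    (h_upper : ∀ i, ∀ k < i, y k (x i) = 0) (k : ℕ) : increment parent y k (x k) = 1 := by
  by_cases hk : k = 0
  · rw [hk, increment, if_pos rfl, h_diag]
  · rw [increment_of_ne_zero y hk, _root_.sub_apply, h_diag, h_upper k _ (h_parent k hk),
      sub_zero]

end Functionals

end Increment

section Biorthogonalization

variable {𝕜 Y : Type*} [NontriviallyNormedField 𝕜] [SeminormedAddCommGroup Y] [NormedSpace 𝕜 Y]

/-- The functionals obtained from `ψ` by Gaussian elimination along the vectors `x`: each `ψ n` is
corrected by multiples of the earlier results so as to vanish at `x i` for `i < n`, provided that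
`ψ n (x n) = 1` for all `n` and `ψ k (x i) = 0` for `k < i`. -/
def biorthogonalize (ψ : ℕ → StrongDual 𝕜 Y) (x : ℕ → Y) (n : ℕ) : StrongDual 𝕜 Y :=
  ψ n - ∑ i : Fin n, ψ n (x i) • biorthogonalize ψ x i

variable {ψ : ℕ → StrongDual 𝕜 Y} {x : ℕ → Y}

theorem biorthogonalize_eq (ψ : ℕ → StrongDual 𝕜 Y) (x : ℕ → Y) (n : ℕ) :
    biorthogonalize ψ x n =
      ψ n - ∑ i ∈ Finset.range n, ψ n (x i) • biorthogonalize ψ x i := by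
  rw [biorthogonalize, Finset.sum_range fun i => ψ n (x i) • biorthogonalize ψ x i]

theorem biorthogonalize_apply (h_diag : ∀ n, ψ n (x n) = 1)
    (h_upper : ∀ i, ∀ k < i, ψ k (x i) = 0) (n i : ℕ) :
    biorthogonalize ψ x n (x i) = if n = i then 1 else 0 := by
  induction n using Nat.strong_induction_on with
  | _ n ih =>
    have hsum : biorthogonalize ψ x n (x i) =
        ψ n (x i) - ∑ k ∈ Finset.range n, if k = i then ψ n (x i) else 0 := by
      rw [biorthogonalize_eq, _root_.sub_apply, _root_.sum_apply]
      refine congrArg (ψ n (x i) - ·) (Finset.sum_congr rfl fun k hk => ?_)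
      rw [_root_.smul_apply, ih k (Finset.mem_range.1 hk), smul_eq_mul]
      split_ifs with hki <;> simp [hki]
    simp only [hsum, Finset.sum_ite_eq', Finset.mem_range]
    rcases lt_trichotomy i n with hin | rfl | hni
    · rw [if_pos hin, sub_self, if_neg hin.ne']
    · rw [if_neg (lt_irrefl i), sub_zero, h_diag, if_pos rfl]
    · rw [if_neg hni.not_gt, sub_zero, h_upper i n hni, if_neg hni.ne]

theorem norm_biorthogonalize_sub_le {B : ℝ} {n : ℕ}
    (hB : ∀ i < n, ‖biorthogonalize ψ x i‖ ≤ B) :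
    ‖biorthogonalize ψ x n - ψ n‖ ≤ (∑ i ∈ Finset.range n, ‖ψ n (x i)‖) * B := by
  rw [biorthogonalize_eq, sub_sub_cancel_left, norm_neg, Finset.sum_mul]
  refine norm_sum_le_of_le _ fun i hi => ?_
  rw [norm_smul]
  exact mul_le_mul_of_nonneg_left (hB i (Finset.mem_range.1 hi)) (norm_nonneg _)

theorem norm_biorthogonalize_le {M : ℝ} (hψ : ∀ n, ‖ψ n‖ ≤ M)
    (hsum : ∀ n, ∑ i ∈ Finset.range n, ‖ψ n (x i)‖ ≤ 1 / 2) (n : ℕ) :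
    ‖biorthogonalize ψ x n‖ ≤ 2 * M := by
  induction n using Nat.strong_induction_on with
  | _ n ih =>
    have hM : 0 ≤ M := (norm_nonneg _).trans (hψ 0)
    calc ‖biorthogonalize ψ x n‖ ≤ ‖ψ n‖ + ‖biorthogonalize ψ x n - ψ n‖ := norm_le_insert' _ _
      _ ≤ M + 1 / 2 * (2 * M) := by
        gcongr
        · exact hψ n
        · exact (norm_biorthogonalize_sub_le ih).trans (by gcongr; exact hsum n)
      _ = 2 * M := by ring

theorem summable_norm_biorthogonalize_sub {M : ℝ} (hψ : ∀ n, ‖ψ n‖ ≤ M)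
    (hsum : ∀ n, ∑ i ∈ Finset.range n, ‖ψ n (x i)‖ ≤ 1 / 2)
    (h_summable : Summable fun n => ∑ i ∈ Finset.range n, ‖ψ n (x i)‖) :
    Summable fun n => ‖biorthogonalize ψ x n - ψ n‖ :=
  .of_nonneg_of_le (fun _ => norm_nonneg _)
    (fun _ => norm_biorthogonalize_sub_le fun i _ => norm_biorthogonalize_le hψ hsum i)
    (h_summable.mul_right (2 * M))

theorem summable_norm_apply_of_summable_norm_sub {φ : ℕ → StrongDual 𝕜 Y}
    (h : Summable fun n => ‖φ n - ψ n‖) {z : Y} (hψ : Summable fun n => ‖ψ n z‖) :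
    Summable fun n => ‖φ n z‖ := by
  refine .of_nonneg_of_le (fun _ => norm_nonneg _) (fun n => ?_) ((h.mul_right ‖z‖).add hψ)
  calc ‖φ n z‖ = ‖(φ n - ψ n) z + ψ n z‖ := by rw [_root_.sub_apply, sub_add_cancel]
    _ ≤ ‖φ n - ψ n‖ * ‖z‖ + ‖ψ n z‖ := norm_add_le_of_le ((φ n - ψ n).le_opNorm z) le_rfl

end Biorthogonalization

section BiorthogonalSequence

theorem sum_range_le_half_pow {a : ℕ → ℝ} {k : ℕ} (ha : ∀ i < k, a i ≤ (1 / 4) ^ k / 2) :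
    ∑ i ∈ Finset.range k, a i ≤ (1 / 2) ^ k / 2 := by
  have hk : (k : ℝ) ≤ 2 ^ k := by exact_mod_cast Nat.lt_two_pow_self.le
  calc ∑ i ∈ Finset.range k, a i ≤ k • ((1 / 4) ^ k / 2 : ℝ) := by
        simpa using Finset.sum_le_card_nsmul _ a _ fun i hi => ha i (Finset.mem_range.1 hi)
    _ ≤ 2 ^ k * ((1 / 4) ^ k / 2) := by
        rw [nsmul_eq_mul]
        gcongr
    _ = (1 / 2) ^ k / 2 := by
        rw [← mul_div_assoc, ← mul_pow]
        norm_num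

variable {𝕜 X Y : Type*} [RCLike 𝕜] [NormedAddCommGroup X] [NormedSpace 𝕜 X]
  [NormedAddCommGroup Y] [NormedSpace 𝕜 Y]

theorem IsDualPerfect.exists_seq {T : X →L[𝕜] Y} {C : ℝ} {S : Set (StrongDual 𝕜 Y)}
    (hS : IsDualPerfect T C S) (hS_nonempty : S.Nonempty) (d : ℕ → Y) {ε : ℕ → ℝ}
    (hε : ∀ k, 0 < ε k) {parent : ℕ → ℕ} (h_parent : ∀ k ≠ 0, parent k < k) :
    ∃ (y : ℕ → StrongDual 𝕜 Y) (u : ℕ → X), (∀ k, y k ∈ S) ∧ (∀ k, ‖u k‖ ≤ C) ∧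
      (∀ k, y k (T (u k)) = 1) ∧ (∀ k, ∀ j < k, y j (T (u k)) = 0) ∧
      ∀ k, ∀ i < k, ‖increment parent y k (d i)‖ < ε k ∧
        ‖increment parent y k (T (u i))‖ < ε k := by
  obtain ⟨y₀, hy₀⟩ := hS_nonempty
  let P (k : ℕ) (f : Fin k → S × X) (a : S × X) : Prop :=
    ‖a.2‖ ≤ C ∧ a.1.1 (T a.2) = 1 ∧ (∀ j, (f j).1.1 (T a.2) = 0) ∧
      ∀ hk : k ≠ 0, ∀ i : Fin k, ‖(a.1.1 - (f ⟨parent k, h_parent k hk⟩).1.1) (d i)‖ < ε k ∧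
        ‖(a.1.1 - (f ⟨parent k, h_parent k hk⟩).1.1) (T (f i).2)‖ < ε k
  have hP (k) (f : Fin k → S × X) : ∃ a, P k f a := by
    let y : S := if hk : k ≠ 0 then (f ⟨parent k, h_parent k hk⟩).1 else ⟨y₀, hy₀⟩
    obtain ⟨a, haS, hay, v, hv, hav, hfv⟩ := hS y y.2
      (Set.range (fun i : Fin k => d i) ∪ Set.range fun i => T (f i).2)
      ((Set.finite_range _).union (Set.finite_range _)) (ε k) (hε k)
      (Set.range fun j => (f j).1.1) (Set.finite_range _)
    refine ⟨(⟨a, haS⟩, v), hv, hav, fun j => hfv _ ⟨j, rfl⟩, fun hk i => ?_⟩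
    simp only [y, dif_pos hk] at hay
    exact ⟨hay _ (.inl ⟨i, rfl⟩), hay _ (.inr ⟨i, rfl⟩)⟩
  obtain ⟨f, hf⟩ := exists_seq_forall_fin hP
  refine ⟨fun k => (f k).1.1, fun k => (f k).2, fun k => (f k).1.2, fun k => (hf k).1,
    fun k => (hf k).2.1, fun k j hj => (hf k).2.2.1 ⟨j, hj⟩, fun k i hi => ?_⟩
  have hk : k ≠ 0 := Nat.ne_zero_of_lt hi
  rw [increment_of_ne_zero _ hk]
  exact (hf k).2.2.2 hk ⟨i, hi⟩

theorem exists_biorthogonal_seq [SeparableSpace Y] {T : X →L[𝕜] Y}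
    (hT : ¬ IsSeparable (Set.range (adjointOp T))) (d : ℕ → Y)
    {parent : ℕ → ℕ} (h_parent : ∀ k ≠ 0, parent k < k) :
    ∃ (C : ℝ) (y φ : ℕ → StrongDual 𝕜 Y) (u : ℕ → X), (∀ k, ‖y k‖ ≤ 1) ∧ (∀ k, ‖u k‖ ≤ C) ∧
      (∀ k i, φ k (T (u i)) = if k = i then 1 else 0) ∧
      (Summable fun k => ‖φ k - increment parent y k‖) ∧ ∀ i, Summable fun k => ‖φ k (d i)‖ := by
  obtain ⟨C, S, hS_nonempty, hS_norm, hS⟩ := exists_isDualPerfect hT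
  obtain ⟨y, u, hyS, hu, h_diag, h_upper, h_small⟩ := hS.exists_seq hS_nonempty d
    (ε := fun k => (1 / 4) ^ k / 2) (fun k => by positivity) h_parent
  have hy (k) : ‖y k‖ ≤ 1 := hS_norm _ (hyS k)
  let ψ := increment parent y
  have hψ_sum (k) : ∑ i ∈ Finset.range k, ‖ψ k (T (u i))‖ ≤ (1 / 2) ^ k / 2 :=
    sum_range_le_half_pow fun i hi => (h_small k i hi).2.le
  have hψ_sum_le (k) : ∑ i ∈ Finset.range k, ‖ψ k (T (u i))‖ ≤ 1 / 2 :=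
    (hψ_sum k).trans (by gcongr; exact pow_le_one₀ (by norm_num) (by norm_num))
  have hφψ : Summable fun k => ‖biorthogonalize ψ (fun i => T (u i)) k - ψ k‖ :=
    summable_norm_biorthogonalize_sub (norm_increment_le hy) hψ_sum_le
      (.of_nonneg_of_le (fun _ => by positivity) hψ_sum (summable_geometric_two.div_const 2))
  refine ⟨C, y, biorthogonalize ψ fun i => T (u i), u, hy, hu,
    biorthogonalize_apply (increment_apply_self (x := T ∘ u) h_parent h_diag h_upper)
      fun _ _ => increment_apply_eq_zero (x := T ∘ u) h_parent h_upper, hφψ,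
    fun i => summable_norm_apply_of_summable_norm_sub hφψ ?_⟩
  refine .of_norm_bounded_eventually_nat
    ((summable_geometric_of_lt_one (by norm_num) (by norm_num : (1 / 4 : ℝ) < 1)).div_const 2) ?_
  filter_upwards [eventually_gt_atTop i] with k hk
  rw [norm_norm]
  exact (h_small k i hk).1.le

end BiorthogonalSequence

section HeapIndex

/-- The position of a node in the breadth-first enumeration of the dyadic tree: the root has
index `0` and the children of the node of index `k` have indices `2 k + 1` and `2 k + 2`. -/
def heapIndex : DyadicTree → ℕ
  | ⟨0, _⟩ => 0
  | ⟨n + 1, v⟩ => Nat.bit (v (Fin.last n)) (heapIndex ⟨n, Fin.init v⟩) + 1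

theorem heapIndex_initSeg_zero (s : CantorSpace) : heapIndex (initSeg s 0) = 0 := by
  rw [initSeg, heapIndex]

theorem heapIndex_initSeg_succ (s : CantorSpace) (n : ℕ) :
    heapIndex (initSeg s (n + 1)) = Nat.bit (s n) (heapIndex (initSeg s n)) + 1 := by
  rw [initSeg, heapIndex]
  rfl

theorem heapIndex_injective : Function.Injective heapIndex := by
  rintro ⟨n, v⟩
  induction n with
  | zero =>
    rintro ⟨m | m, w⟩ h
    · rw [Subsingleton.elim v w]
    · simp [heapIndex] at h
  | succ n ih =>
    rintro ⟨m | m, w⟩ h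
    · simp [heapIndex] at h
    · rw [heapIndex, heapIndex, Nat.add_right_cancel_iff] at h
      have h_last : v (Fin.last n) = w (Fin.last m) := by
        simpa only [Nat.bodd_bit] using congrArg Nat.bodd h
      have h_parent : heapIndex ⟨n, Fin.init v⟩ = heapIndex ⟨m, Fin.init w⟩ := by
        simpa only [Nat.div2_bit] using congrArg Nat.div2 h
      obtain ⟨rfl, h_init⟩ := Sigma.mk.inj (ih _ h_parent)
      rw [← Fin.snoc_init_self v, ← Fin.snoc_init_self w, h_last, eq_of_heq h_init]

theorem norm_sum_increment_branch_le {E : Type*} [SeminormedAddCommGroup E] {y : ℕ → E} {M : ℝ}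
    (hy : ∀ k, ‖y k‖ ≤ M) (s : CantorSpace) (n : ℕ) :
    ‖∑ m ∈ Finset.range n, increment (fun k => (k - 1) / 2) y (heapIndex (initSeg s m))‖ ≤ M := by
  cases n with
  | zero => simpa using (norm_nonneg _).trans (hy 0)
  | succ n =>
    rw [sum_increment_path y (path := fun m => heapIndex (initSeg s m)) (heapIndex_initSeg_zero s)]
    · exact hy _
    · intro m
      rw [heapIndex_initSeg_succ]
      exact ⟨Nat.succ_ne_zero _, Nat.bit_div_two _ _⟩

end HeapIndex

section BiorthogonalTree

variable {𝕜 X Y : Type*} [RCLike 𝕜] [NormedAddCommGroup X] [NormedSpace 𝕜 X]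
  [NormedAddCommGroup Y] [NormedSpace 𝕜 Y]

theorem exists_biorthogonal_tree [SeparableSpace Y] {T : X →L[𝕜] Y}
    (hT : ¬ IsSeparable (Set.range (adjointOp T))) (d : ℕ → Y) :
    ∃ (B C : ℝ) (φ : DyadicTree → StrongDual 𝕜 Y) (u : DyadicTree → X),
      (∀ t, ‖u t‖ ≤ C) ∧ (∀ r t, φ r (T (u t)) = if r = t then 1 else 0) ∧
      (∀ s n, ‖∑ m ∈ Finset.range n, φ (initSeg s m)‖ ≤ B) ∧
      ∀ i, Summable fun t => ‖φ t (d i)‖ := by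
  obtain ⟨C, y, φ, u, hy, hu, hφu, hφψ, hφd⟩ :=
    exists_biorthogonal_seq hT d (parent := fun k => (k - 1) / 2) (by omega)
  let ψ := increment (fun k => (k - 1) / 2) y
  refine ⟨(∑' k, ‖φ k - ψ k‖) + 1, C, fun t => φ (heapIndex t), fun t => u (heapIndex t),
    fun t => hu _, fun r t => ?_, fun s n => ?_,
    fun i => (hφd i).comp_injective heapIndex_injective⟩
  · simp only [hφu, heapIndex_injective.eq_iff]
  · let k (m : ℕ) := heapIndex (initSeg s m)
    have hk : Function.Injective k := heapIndex_injective.comp (initSeg_injective s)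
    calc ‖∑ m ∈ Finset.range n, φ (k m)‖
        = ‖∑ m ∈ Finset.range n, (φ (k m) - ψ (k m)) + ∑ m ∈ Finset.range n, ψ (k m)‖ := by
          rw [Finset.sum_sub_distrib, sub_add_cancel]
      _ ≤ (∑ m ∈ Finset.range n, ‖φ (k m) - ψ (k m)‖) + 1 :=
          norm_add_le_of_le (norm_sum_le _ _) (norm_sum_increment_branch_le hy s n)
      _ ≤ (∑' m, ‖φ (k m) - ψ (k m)‖) + 1 := by
          gcongr
          exact (hφψ.comp_injective hk).sum_le_tsum _ fun _ _ => norm_nonneg _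
      _ ≤ (∑' k, ‖φ k - ψ k‖) + 1 := by
          have := tsum_comp_le_tsum_of_inj hφψ (fun _ => norm_nonneg _) hk
          exact add_le_add_left this 1

end BiorthogonalTree

section SummableEval

variable {ι 𝕜 Y : Type*} [NormedField 𝕜] [AddCommGroup Y] [Module 𝕜 Y] [TopologicalSpace Y]

/-- The subspace of the vectors at which a family of functionals takes absolutely summable
values. -/
def summableDomain (φ : ι → StrongDual 𝕜 Y) : Submodule 𝕜 Y where
  carrier := {z | Summable fun i => ‖φ i z‖}
  add_mem' {z w} hz hw := by
    refine .of_nonneg_of_le (fun _ => norm_nonneg _) (fun i => ?_) (hz.add hw)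
    rw [map_add]
    exact norm_add_le _ _
  zero_mem' := by simp [summable_zero]
  smul_mem' c z hz := by
    have h := hz.mul_left ‖c‖
    simpa only [Set.mem_ofPred_eq, map_smul, norm_smul] using h

theorem mem_summableDomain {φ : ι → StrongDual 𝕜 Y} {z : Y} :
    z ∈ summableDomain φ ↔ Summable fun i => ‖φ i z‖ :=
  Iff.rfl

/-- The evaluation `z ↦ (φ i z)ᵢ`, with values in `ℓ₁`. It need not be bounded. -/
def summableEval (φ : ι → StrongDual 𝕜 Y) : summableDomain φ →ₗ[𝕜] lp (fun _ : ι => 𝕜) 1 where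
  toFun z := ⟨fun i => φ i z, memℓp_gen (by simpa using mem_summableDomain.1 z.2)⟩
  map_add' z w := by
    ext i
    exact map_add (φ i) _ _
  map_smul' c z := by
    ext i
    exact map_smul (φ i) _ _

theorem summableEval_apply (φ : ι → StrongDual 𝕜 Y) (z : summableDomain φ) (i : ι) :
    summableEval φ z i = φ i z :=
  rfl

end SummableEval

section Factorization

theorem exists_clm_apply_single {ι 𝕜 X : Type*} [DecidableEq ι] [NontriviallyNormedField 𝕜]
    [NormedAddCommGroup X] [NormedSpace 𝕜 X] [CompleteSpace X] {u : ι → X} {C : ℝ}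
    (hu : ∀ i, ‖u i‖ ≤ C) :
    ∃ U : lp (fun _ : ι => 𝕜) 1 →L[𝕜] X, ∀ i, U (lp.single 1 i 1) = u i := by
  have h_norm (a : lp (fun _ : ι => 𝕜) 1) : HasSum (fun i => ‖a i‖) ‖a‖ := by
    simpa using lp.hasSum_norm (by simp) a
  have h_le (a : lp (fun _ : ι => 𝕜) 1) (i : ι) : ‖a i • u i‖ ≤ C * ‖a i‖ := by
    rw [norm_smul, mul_comm]
    gcongr
    exact hu i
  have h_summable (a : lp (fun _ : ι => 𝕜) 1) : Summable fun i => a i • u i :=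
    .of_norm_bounded ((h_norm a).summable.mul_left C) (h_le a)
  let U : lp (fun _ : ι => 𝕜) 1 →ₗ[𝕜] X :=
    { toFun := fun a => ∑' i, a i • u i
      map_add' := fun a b => by
        simp only [lp.coeFn_add, Pi.add_apply, add_smul, (h_summable a).tsum_add (h_summable b)]
      map_smul' := fun c a => by
        simp only [lp.coeFn_smul, Pi.smul_apply, smul_assoc, (h_summable a).tsum_const_smul,
          RingHom.id_apply] }
  refine ⟨U.mkContinuous C fun a => tsum_of_norm_bounded ((h_norm a).mul_left C) (h_le a),
    fun i => ?_⟩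
  have h_ne (j : ι) (hj : j ≠ i) : lp.single (E := fun _ : ι => 𝕜) 1 i 1 j • u j = 0 := by
    rw [lp.single_apply_ne _ _ _ hj, zero_smul]
  exact (tsum_eq_single i h_ne).trans (by rw [lp.single_apply_self, one_smul])

variable {𝕜 : Type*} [RCLike 𝕜]

theorem branchSumOp_apply (x : ell1Dyadic 𝕜) (s : CantorSpace) :
    branchSumOp 𝕜 x s = ∑' n, x (initSeg s n) :=
  rfl

theorem hasSum_branchSumOp (x : ell1Dyadic 𝕜) (s : CantorSpace) :
    HasSum (fun n => x (initSeg s n)) (branchSumOp 𝕜 x s) :=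
  (summable_branch x s).hasSum

variable {X Y : Type*} [NormedAddCommGroup X] [NormedSpace 𝕜 X]
  [NormedAddCommGroup Y] [NormedSpace 𝕜 Y]

theorem norm_branchSumOp_summableEval_le {φ : DyadicTree → StrongDual 𝕜 Y} {B : ℝ}
    (hφ : ∀ s n, ‖∑ m ∈ Finset.range n, φ (initSeg s m)‖ ≤ B) (z : summableDomain φ) :
    ‖branchSumOp 𝕜 (summableEval φ z)‖ ≤ B * ‖z‖ := by
  have hB : 0 ≤ B := (norm_nonneg _).trans (hφ (fun _ => false) 0)
  refine (ContinuousMap.norm_le _ (by positivity)).2 fun s => ?_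
  refine le_of_tendsto (hasSum_branchSumOp (summableEval φ z) s).tendsto_sum_nat.norm
    (.of_forall fun n => ?_)
  simp only [summableEval_apply]
  rw [← _root_.sum_apply]
  exact ContinuousLinearMap.le_of_opNorm_le _ (hφ s n) _

theorem exists_clm_apply_eq_branchSumOp {φ : DyadicTree → StrongDual 𝕜 Y} {B : ℝ}
    (hφ : ∀ s n, ‖∑ m ∈ Finset.range n, φ (initSeg s m)‖ ≤ B)
    (h_dense : Dense (summableDomain φ : Set Y)) :
    ∃ V : Y →L[𝕜] C(CantorSpace, 𝕜),
      ∀ z : summableDomain φ, V z = branchSumOp 𝕜 (summableEval φ z) :=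
  ⟨((branchSumOp 𝕜).toLinearMap ∘ₗ summableEval φ).extendOfNorm (summableDomain φ).subtype,
    LinearMap.extendOfNorm_eq (by simpa [DenseRange] using h_dense)
      ⟨B, norm_branchSumOp_summableEval_le hφ⟩⟩

theorem factorsThrough_of_biorthogonal_tree [CompleteSpace X] {T : X →L[𝕜] Y}
    {φ : DyadicTree → StrongDual 𝕜 Y} {u : DyadicTree → X} {B C : ℝ} (hu : ∀ t, ‖u t‖ ≤ C)
    (hφu : ∀ r t, φ r (T (u t)) = if r = t then 1 else 0)
    (hφ : ∀ s n, ‖∑ m ∈ Finset.range n, φ (initSeg s m)‖ ≤ B)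
    (h_dense : Dense (summableDomain φ : Set Y)) : FactorsThrough (branchSumOp 𝕜) T := by
  obtain ⟨V, hV⟩ := exists_clm_apply_eq_branchSumOp hφ h_dense
  obtain ⟨U, hU⟩ := exists_clm_apply_single (𝕜 := 𝕜) hu
  have hmem (t) : T (u t) ∈ summableDomain φ := mem_summableDomain.2 <|
    summable_of_ne_finset_zero (s := {t}) fun r hr => by
      rw [hφu, if_neg (Finset.notMem_singleton.1 hr), norm_zero]
  have heval (t) : summableEval φ ⟨T (u t), hmem t⟩ = unitVec 𝕜 t := by
    ext r
    simp [summableEval_apply, hφu, unitVec, lp.single_apply, Pi.single_apply]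
  refine ⟨U, V, lp.ext_continuousLinearMap ENNReal.one_ne_top fun t => ?_⟩
  ext1
  calc V (T (U (unitVec 𝕜 t))) = V (T (u t)) := by rw [unitVec, hU]
    _ = branchSumOp 𝕜 (unitVec 𝕜 t) := by rw [← heval t, ← hV]

theorem factorsThrough_of_not_isSeparable [CompleteSpace X] [SeparableSpace Y] {T : X →L[𝕜] Y}
    (hT : ¬ IsSeparable (Set.range (adjointOp T))) : FactorsThrough (branchSumOp 𝕜) T := by
  obtain ⟨B, C, φ, u, hu, hφu, hφ, hφd⟩ := exists_biorthogonal_tree hT (denseSeq Y)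
  refine factorsThrough_of_biorthogonal_tree hu hφu hφ ?_
  exact (denseRange_denseSeq Y).mono (Set.range_subset_iff.2 hφd)

end Factorization

section Membership

variable {𝕜 : Type*} [RCLike 𝕜]

theorem mem_cylinder_iff {t : DyadicTree} {s : CantorSpace} :
    s ∈ cylinder t ↔ initSeg s t.1 = t := by
  obtain ⟨n, v⟩ := t
  simp only [cylinder, initSeg, Set.mem_ofPred_eq, Sigma.mk.injEq, heq_eq_eq, true_and]
  exact funext_iff.symm

theorem branchSumOp_unitVec (t : DyadicTree) :
    ⇑(branchSumOp 𝕜 (unitVec 𝕜 t)) = Set.indicator (cylinder t) fun _ => (1 : 𝕜) := by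
  classical
  funext s
  rw [branchSumOp_apply, tsum_eq_single t.1]
  · simp only [unitVec, lp.single_apply, Set.indicator_apply, Pi.single_apply, mem_cylinder_iff]
  · intro n hn
    rw [unitVec, lp.single_apply, Pi.single_apply, if_neg]
    rintro rfl
    exact hn rfl

theorem not_isSeparable_range_of_pairwise_le_dist {ι E : Type*} [PseudoMetricSpace E]
    [Uncountable ι] {f : ι → E} {r : ℝ} (hr : 0 < r)
    (hf : Pairwise fun i j => r ≤ dist (f i) (f j)) : ¬ IsSeparable (Set.range f) := by
  intro h_sep
  have := h_sep.separableSpace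
  have h_disjoint : Pairwise (Function.onFun Disjoint
      fun i => Metric.ball (Set.rangeFactorization f i) (r / 2)) := fun i j hij =>
    Metric.ball_disjoint_ball ((add_halves r).trans_le (hf hij))
  have h_countable : Countable ι := h_disjoint.countable_of_isOpen_disjoint
    (fun _ => Metric.isOpen_ball) fun _ => Metric.nonempty_ball.2 (half_pos hr)
  exact not_countable h_countable

theorem one_le_dist_adjointOp_evalCLM {s s' : CantorSpace} (h : s ≠ s') :
    1 ≤ dist (adjointOp (branchSumOp 𝕜) (ContinuousMap.evalCLM 𝕜 s))
      (adjointOp (branchSumOp 𝕜) (ContinuousMap.evalCLM 𝕜 s')) := by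
  obtain ⟨n, hn⟩ := Function.ne_iff.1 h
  let t : DyadicTree := initSeg s (n + 1)
  have hs : branchSumOp 𝕜 (unitVec 𝕜 t) s = 1 := by
    rw [branchSumOp_unitVec, Set.indicator_of_mem (mem_cylinder_iff.2 rfl)]
  have hs' : branchSumOp 𝕜 (unitVec 𝕜 t) s' = 0 := by
    rw [branchSumOp_unitVec, Set.indicator_of_notMem]
    exact fun hmem => hn (hmem (Fin.last n)).symm
  have hdiff : (adjointOp (branchSumOp 𝕜) (ContinuousMap.evalCLM 𝕜 s) -
      adjointOp (branchSumOp 𝕜) (ContinuousMap.evalCLM 𝕜 s')) (unitVec 𝕜 t) = 1 := by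
    change branchSumOp 𝕜 (unitVec 𝕜 t) s - branchSumOp 𝕜 (unitVec 𝕜 t) s' = 1
    rw [hs, hs', sub_zero]
  have hle := ContinuousLinearMap.le_opNorm (adjointOp (branchSumOp 𝕜)
    (ContinuousMap.evalCLM 𝕜 s) - adjointOp (branchSumOp 𝕜) (ContinuousMap.evalCLM 𝕜 s'))
    (unitVec 𝕜 t)
  rwa [hdiff, norm_one, unitVec, lp.norm_single (by simp), norm_one, mul_one, ← dist_eq_norm]
    at hle

theorem sepCodNonsepAdj_branchSumOp : SepCodNonsepAdj (branchSumOp 𝕜) := by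
  have : Uncountable CantorSpace := by
    rw [← Cardinal.aleph0_lt_mk_iff]
    simp [Cardinal.aleph0_lt_continuum]
  refine ⟨inferInstance, fun h => not_isSeparable_range_of_pairwise_le_dist one_pos
    (f := fun s => adjointOp (branchSumOp 𝕜) (ContinuousMap.evalCLM 𝕜 s))
    (fun _ _ => one_le_dist_adjointOp_evalCLM) (h.mono ?_)⟩
  rintro _ ⟨s, rfl⟩
  exact Set.mem_range_self _

end Membership

end UnivOp

theorem mainTheorem7_general (𝕜 : Type w) [RCLike 𝕜] :
    (∀ (x : UnivOp.ell1Dyadic 𝕜) (s : UnivOp.CantorSpace),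
      HasSum (fun n : ℕ => x (UnivOp.initSeg s n)) (UnivOp.branchSumOp 𝕜 x s)) ∧
    (∀ t : UnivOp.DyadicTree,
      ⇑(UnivOp.branchSumOp 𝕜 (UnivOp.unitVec 𝕜 t)) =
        Set.indicator (UnivOp.cylinder t) (fun _ => (1 : 𝕜))) ∧
    UnivOp.SepCodNonsepAdj (UnivOp.branchSumOp 𝕜) ∧
    ∀ (X : Type u) (Y : Type v) [NormedAddCommGroup X] [NormedSpace 𝕜 X] [CompleteSpace X]
      [NormedAddCommGroup Y] [NormedSpace 𝕜 Y] (T : X →L[𝕜] Y),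
      UnivOp.SepCodNonsepAdj T → UnivOp.FactorsThrough (UnivOp.branchSumOp 𝕜) T :=
  ⟨UnivOp.hasSum_branchSumOp, UnivOp.branchSumOp_unitVec, UnivOp.sepCodNonsepAdj_branchSumOp,
    fun _ _ _ _ _ _ _ _ hT => have := hT.1; UnivOp.factorsThrough_of_not_isSeparable hT.2⟩

theorem mainTheorem7 (𝕜 : Type w) [RCLike 𝕜] :
    (∀ (x : UnivOp.ell1Dyadic 𝕜) (s : UnivOp.CantorSpace),
      HasSum (fun n : ℕ => x (UnivOp.initSeg s n)) (UnivOp.branchSumOp 𝕜 x s)) ∧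
    (∀ t : UnivOp.DyadicTree,
      ⇑(UnivOp.branchSumOp 𝕜 (UnivOp.unitVec 𝕜 t)) =
        Set.indicator (UnivOp.cylinder t) (fun _ => (1 : 𝕜))) ∧
    (∀ (X : Type u) (Y : Type v) [NormedAddCommGroup X] [NormedSpace 𝕜 X] [CompleteSpace X]
      [NormedAddCommGroup Y] [NormedSpace 𝕜 Y] [CompleteSpace Y] (T : X →L[𝕜] Y),
      TopologicalSpace.SeparableSpace Y →
      ¬ TopologicalSpace.IsSeparable (Set.range (UnivOp.adjointOp T)) →
      UnivOp.FactorsThrough (UnivOp.branchSumOp 𝕜) T) ∧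
    UnivOp.IsUniversalSepCodNonsepAdj.{u, v} (UnivOp.branchSumOp 𝕜) :=
  let ⟨hasSum_apply, apply_unitVec, mem_class, factors⟩ := mainTheorem7_general 𝕜
  ⟨hasSum_apply, apply_unitVec, fun X Y _ _ _ _ _ _ T hY hT => factors X Y T ⟨hY, hT⟩,
    mem_class, fun X Y _ _ _ _ _ _ T => factors X Y T⟩
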